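/- Let $R$ be a commutative Noetherian ring and let $\Phi$ be a system of ideals of $R$, that is, a non-empty set of ideals of $R$ such that for all $\mathfrak a_1,\mathfrak a_2\in\Phi$ there is $\mathfrak b\in\Phi$ with $\mathfrak b\subseteq\mathfrak a_1\mathfrak a_2$. For an $R$-module $M$ put $$\Gamma_\Phi(M)=\{x\in M \mid \mathfrak a x=0 \text{ for some } \mathfrak a\in\Phi\},$$ and for $i\ge 0$ let $H^i_\Phi$ denote the $i$-th right derived functor of the functor $\Gamma_\Phi$ on the category of $R$-modules. Let $N$ be a finitely generated $R$-module that is $\Phi$-torsion, i.e. $\Gamma_\Phi(N)=N$, let $M$ be an arbitrary $R$-module, and let $s,t$ be non-negative integers. Assume that (i) $\operatorname{Ext}^{s+t-i}_R(N,H^i_\Phi(M))=0$ for all $i$ with $0\le i<t$ or $t+1\le i\le s+t$; (ii) $\operatorname{Ext}^{s+1+i}_R(N,H^{t-i}_\Phi(M))=0$ for all $i$ with $0\le i\le t$; (iii) $\operatorname{Ext}^{s-1-i}_R(N,H^{t+i}_\Phi(M))=0$ for all $i$ with $0\le i\le s-1$. Then there is an isomorphism of $R$-modules $$\operatorname{Ext}^{s+t}_R(N,M)\cong\operatorname{Ext}^{s}_R(N,H^t_\Phi(M)).$$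 -/

import Mathlib

universe u v

open CategoryTheory

/-- A system of ideals of `R`: a non-empty set `Φ` of ideals such that for all `a₁, a₂ ∈ Φ` there is
`b ∈ Φ` with `b ⊆ a₁ a₂`. -/
structure SystemOfIdeals (R : Type u) [CommRing R] where
  /-- the underlying set of ideals -/
  ideals : Set (Ideal R)
  nonempty : ideals.Nonempty
  exists_le_mul : ∀ a₁ ∈ ideals, ∀ a₂ ∈ ideals, ∃ b ∈ ideals, b ≤ a₁ * a₂

namespace SystemOfIdeals

variable {R : Type u} [CommRing R] (Φ : SystemOfIdeals R)

/-- `Γ_Φ(M) = {x ∈ M | a x = 0 for some a ∈ Φ}`, as a submodule of `M`. -/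
def torsionSubmodule (M : Type v) [AddCommGroup M] [Module R M] : Submodule R M where
  carrier := {x | ∃ a ∈ Φ.ideals, ∀ r ∈ a, r • x = 0}
  zero_mem' := by
    obtain ⟨a, ha⟩ := Φ.nonempty
    exact ⟨a, ha, fun r _ => smul_zero r⟩
  add_mem' := by
    rintro x y ⟨a₁, h₁, hx⟩ ⟨a₂, h₂, hy⟩
    obtain ⟨b, hb, hle⟩ := Φ.exists_le_mul a₁ h₁ a₂ h₂
    have h1 : b ≤ a₁ := hle.trans (Ideal.mul_le_inf.trans inf_le_left)
    have h2 : b ≤ a₂ := hle.trans (Ideal.mul_le_inf.trans inf_le_right)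
    refine ⟨b, hb, fun r hr => ?_⟩
    rw [smul_add, hx r (h1 hr), hy r (h2 hr), add_zero]
  smul_mem' := by
    rintro c x ⟨a, ha, hx⟩
    refine ⟨a, ha, fun r hr => ?_⟩
    rw [smul_comm, hx r hr, smul_zero]

/-- `M` is `Φ`-torsion if `Γ_Φ(M) = M`. -/
def IsTorsion (M : Type v) [AddCommGroup M] [Module R M] : Prop :=
  Φ.torsionSubmodule M = ⊤

theorem map_mem_torsionSubmodule {M M' : Type v} [AddCommGroup M] [Module R M]
    [AddCommGroup M'] [Module R M'] (f : M →ₗ[R] M') {x : M} (hx : x ∈ Φ.torsionSubmodule M) :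
    f x ∈ Φ.torsionSubmodule M' := by
  obtain ⟨a, ha, h⟩ := hx
  exact ⟨a, ha, fun r hr => by rw [← map_smul, h r hr, map_zero]⟩

/-- The functor `Γ_Φ` from `R`-modules to `R`-modules; on morphisms it is restriction. -/
def torsionFunctor : ModuleCat.{v} R ⥤ ModuleCat.{v} R where
  obj M := ModuleCat.of R (Φ.torsionSubmodule M)
  map f := ModuleCat.ofHom
    (f.hom.restrict fun _ hx => Φ.map_mem_torsionSubmodule f.hom hx)

instance torsionFunctor_additive : (torsionFunctor.{u, v} Φ).Additive where

/-- The `i`-th general local cohomology functor `H^i_Φ`: the `i`-th right derived functor of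
`Γ_Φ`. -/
noncomputable def localCohomology [Small.{v} R] (i : ℕ) : ModuleCat.{v} R ⥤ ModuleCat.{v} R :=
  (torsionFunctor.{u, v} Φ).rightDerived i

end SystemOfIdeals

/-! Let `I` be an injective resolution of `M` and `J = Γ_Φ(I)`. By Artin-Rees `J` still consists of
injectives, and its cohomology is `H^q_Φ(M)`. As `N` is torsion, `Hom(N, J) = Hom(N, I)`, which has
cohomology `Ext(N, M)`. This is the setting of the spectral sequence `Ext^a(N, H^q_Φ(M)) ⇒
Ext^{a+q}(N, M)`, where the hypotheses isolate the term `(s, t)`.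

The spectral sequence is replaced by dimension shifting along `0 → B^n → Z^n → H^n → 0` and `0 → Z^n
→ J^n → B^{n+1} → 0`. Terms with `q < t` give `Ext^s(N, Z^t) ≅ Ext^s(N, H^t)`. Terms with `q > t`
allow moving from `Ext^s(N, Z^t)` up to `Ext^1(N, Z^{s+t-1})`, which is the cohomology of `Hom(N,
J)` in degree `s + t`. The case `s = 0` is treated directly. -/

/-! ### Consequences of the long exact sequence of `Ext` -/

namespace CategoryTheory.Abelian.Ext

open Limits

universe w t v' u'

variable {R : Type t} [CommRing R] {C : Type u'} [Category.{v'} C] [Abelian C] [Linear R C]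
  [HasExt.{w} C]

/-- The linear equivalence on `Ext` induced by an isomorphism in the second variable. -/
noncomputable def postcompIso (R : Type t) [CommRing R] [Linear R C] (N : C) {X Y : C}
    (e : X ≅ Y) (n : ℕ) : Ext N X n ≃ₗ[R] Ext N Y n :=
  LinearEquiv.ofLinearMap ((mk₀ e.hom).postcompOfLinear R N (add_zero n))
    ((mk₀ e.inv).postcompOfLinear R N (add_zero n))
    (by ext x; simp) (by ext x; simp)

lemma subsingleton_of_isZero (N : C) {X : C} (hX : IsZero X) (n : ℕ) :
    Subsingleton (Ext N X n) := by
  refine subsingleton_of_forall_eq 0 fun x => ?_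
  rw [← comp_mk₀_id x, hX.eq_of_src (𝟙 X) 0, mk₀_zero, comp_zero]

lemma bijective_extZero_postcomp (R : Type t) [CommRing R] [Linear R C] {N X Y : C} (f : X ⟶ Y)
    (hf : Function.Bijective fun g : N ⟶ X => g ≫ f) :
    Function.Bijective ((mk₀.{w} f).postcompOfLinear R N (add_zero 0)) := by
  have h : ((mk₀.{w} f).postcompOfLinear R N (add_zero 0) : Ext N X 0 → Ext N Y 0) =
      addEquiv₀.symm ∘ (fun g : N ⟶ X => g ≫ f) ∘ addEquiv₀ := by
    ext1 x
    obtain ⟨g, rfl⟩ := addEquiv₀.symm.surjective x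
    simp only [Function.comp_apply, AddEquiv.apply_symm_apply]
    simp
  rw [h]
  exact addEquiv₀.symm.bijective.comp (hf.comp addEquiv₀.bijective)

section ShortExact

variable {S : ShortComplex C} (hS : S.ShortExact) (N : C)
include hS

lemma subsingleton_middle {n : ℕ} (h₁ : Subsingleton (Ext N S.X₁ n))
    (h₃ : Subsingleton (Ext N S.X₃ n)) : Subsingleton (Ext N S.X₂ n) := by
  refine subsingleton_of_forall_eq 0 fun x => ?_
  obtain ⟨y, rfl⟩ := covariant_sequence_exact₂ N hS x (Subsingleton.elim _ _)
  rw [Subsingleton.elim y 0, zero_comp]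

lemma subsingleton_right {n : ℕ} (h₂ : Subsingleton (Ext N S.X₂ n))
    (h₁ : Subsingleton (Ext N S.X₁ (n + 1))) : Subsingleton (Ext N S.X₃ n) := by
  refine subsingleton_of_forall_eq 0 fun x => ?_
  obtain ⟨y, rfl⟩ := covariant_sequence_exact₃ N hS x rfl (Subsingleton.elim _ _)
  rw [Subsingleton.elim y 0, zero_comp]

lemma postcomp_g_surjective {n : ℕ} (h₁ : Subsingleton (Ext N S.X₁ (n + 1))) :
    Function.Surjective ((mk₀ S.g).postcompOfLinear R N (add_zero n)) :=
  fun x => covariant_sequence_exact₃ N hS x rfl (Subsingleton.elim _ _)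

lemma ker_postcomp_g (n : ℕ) :
    LinearMap.ker ((mk₀ S.g).postcompOfLinear R N (add_zero n)) =
      LinearMap.range ((mk₀ S.f).postcompOfLinear R N (add_zero n)) := by
  ext x
  constructor
  · exact fun hx => covariant_sequence_exact₂ N hS x hx
  · rintro ⟨y, rfl⟩
    simp

lemma ker_postcomp_extClass (n : ℕ) :
    LinearMap.ker (hS.extClass.postcompOfLinear R N (rfl : n + 1 = n + 1)) =
      LinearMap.range ((mk₀ S.g).postcompOfLinear R N (add_zero n)) := by
  ext x
  constructor
  · exact fun hx => covariant_sequence_exact₃ N hS x rfl hx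
  · rintro ⟨y, rfl⟩
    simp

lemma postcomp_extClass_surjective {n : ℕ} (h₂ : Subsingleton (Ext N S.X₂ (n + 1))) :
    Function.Surjective (hS.extClass.postcompOfLinear R N (rfl : n + 1 = n + 1)) :=
  fun x => covariant_sequence_exact₁ N hS x (Subsingleton.elim _ _) rfl

lemma nonempty_equiv_g {n : ℕ} (h₁ : Subsingleton (Ext N S.X₁ n))
    (h₁' : Subsingleton (Ext N S.X₁ (n + 1))) :
    Nonempty (Ext N S.X₂ n ≃ₗ[R] Ext N S.X₃ n) := by
  refine ⟨LinearEquiv.ofBijective ((mk₀ S.g).postcompOfLinear R N (add_zero n))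
    ⟨?_, postcomp_g_surjective hS N h₁'⟩⟩
  rw [← LinearMap.ker_eq_bot, ker_postcomp_g hS, LinearMap.range_eq_bot]
  exact Subsingleton.elim _ _

lemma nonempty_equiv_extClass {n : ℕ} (h₂ : Subsingleton (Ext N S.X₂ n))
    (h₂' : Subsingleton (Ext N S.X₂ (n + 1))) :
    Nonempty (Ext N S.X₃ n ≃ₗ[R] Ext N S.X₁ (n + 1)) := by
  refine ⟨LinearEquiv.ofBijective (hS.extClass.postcompOfLinear R N rfl)
    ⟨?_, postcomp_extClass_surjective hS N h₂'⟩⟩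
  rw [← LinearMap.ker_eq_bot, ker_postcomp_extClass hS, LinearMap.range_eq_bot]
  exact Subsingleton.elim _ _

lemma nonempty_equiv_f {n : ℕ} (h₃ : Subsingleton (Ext N S.X₃ n))
    (h₃' : Subsingleton (Ext N S.X₃ (n + 1))) :
    Nonempty (Ext N S.X₁ (n + 1) ≃ₗ[R] Ext N S.X₂ (n + 1)) := by
  refine ⟨LinearEquiv.ofBijective ((mk₀ S.f).postcompOfLinear R N (add_zero (n + 1)))
    ⟨(injective_iff_map_eq_zero _).2 fun x hx => ?_, fun x => ?_⟩⟩
  · obtain ⟨y, rfl⟩ := covariant_sequence_exact₁ N hS x hx rfl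
    rw [Subsingleton.elim y 0, zero_comp]
  · exact covariant_sequence_exact₂ N hS x (Subsingleton.elim _ _)

end ShortExact

end CategoryTheory.Abelian.Ext

/-! ### Dimension shifting along cycles and boundaries -/

namespace CochainComplex

open Limits

universe w t v' u'

variable {C : Type u'} [Category.{v'} C] [Abelian C] (K : CochainComplex C ℕ)

/-- The image of `K.X m` in the cycles of degree `n`. -/
noncomputable abbrev boundaries (m n : ℕ) : C :=
  image (K.toCycles m n)

/-- Used for `m = n = 0`: the predecessor of `0` is `0` by convention, and `B^0 = 0`. -/
lemma isZero_boundaries {m n : ℕ} (h : m + 1 ≠ n) : IsZero (K.boundaries m n) := by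
  have h : K.toCycles m n = 0 := K.toCycles_eq_zero (by simpa using h)
  rw [IsZero.iff_id_eq_zero, ← cancel_mono (image.ι _),
    ← cancel_epi (factorThruImage (K.toCycles m n))]
  simp [h]

/-- The short complex `boundaries ⟶ cycles ⟶ homology`. -/
noncomputable abbrev boundariesSequence (m n : ℕ) : ShortComplex C :=
  ShortComplex.mk (image.ι (K.toCycles m n)) (K.homologyπ n) (by
    rw [← cancel_epi (factorThruImage (K.toCycles m n))]
    simp)

lemma boundariesSequence_shortExact {m n : ℕ} (hm : (ComplexShape.up ℕ).prev n = m) :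
    (K.boundariesSequence m n).ShortExact where
  exact := by
    have h : (ShortComplex.mk (K.toCycles m n) (K.homologyπ n) (by simp)).Exact :=
      ShortComplex.exact_of_g_is_cokernel _ (K.homologyIsCokernel _ n hm)
    let φ : ShortComplex.mk (K.toCycles m n) (K.homologyπ n) (by simp) ⟶
        K.boundariesSequence m n :=
      { τ₁ := factorThruImage _, τ₂ := 𝟙 _, τ₃ := 𝟙 _ }
    have : Epi φ.τ₁ := inferInstanceAs (Epi (factorThruImage _))
    have : IsIso φ.τ₂ := inferInstanceAs (IsIso (𝟙 _))
    have : Mono φ.τ₃ := inferInstanceAs (Mono (𝟙 _))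
    exact (ShortComplex.exact_iff_of_epi_of_isIso_of_mono φ).1 h

/-- The short complex `cycles ⟶ X ⟶ boundaries`. -/
noncomputable abbrev cyclesSequence (n : ℕ) : ShortComplex C :=
  ShortComplex.mk (K.iCycles n) (factorThruImage (K.toCycles n (n + 1))) (by
    rw [← cancel_mono (image.ι _), ← cancel_mono (K.iCycles (n + 1))]
    simp)

lemma cyclesSequence_shortExact (n : ℕ) : (K.cyclesSequence n).ShortExact where
  exact := by
    have h : (ShortComplex.mk (K.iCycles n) (K.d n (n + 1)) (by simp)).Exact :=
      ShortComplex.exact_of_f_is_kernel _ (K.cyclesIsKernel n (n + 1) (by simp))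
    let φ : K.cyclesSequence n ⟶ ShortComplex.mk (K.iCycles n) (K.d n (n + 1)) (by simp) :=
      { τ₁ := 𝟙 _, τ₂ := 𝟙 _, τ₃ := image.ι _ ≫ K.iCycles _ }
    have : Epi φ.τ₁ := inferInstanceAs (Epi (𝟙 _))
    have : IsIso φ.τ₂ := inferInstanceAs (IsIso (𝟙 _))
    have : Mono φ.τ₃ := inferInstanceAs (Mono (image.ι _ ≫ K.iCycles _))
    exact (ShortComplex.exact_iff_of_epi_of_isIso_of_mono φ).2 h

/-- Lift to `K.X n` by surjectivity there; injectivity in degree `n + 1` shows that the lift is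
killed by the differential. -/
lemma bijective_comp_cyclesMap {L : CochainComplex C ℕ} {N : C} (φ : K ⟶ L)
    (hφ : ∀ i, Function.Bijective fun f : N ⟶ K.X i => f ≫ φ.f i) (n : ℕ) :
    Function.Bijective fun f : N ⟶ K.cycles n => f ≫ HomologicalComplex.cyclesMap φ n := by
  refine ⟨fun f g hfg => ?_, fun f => ?_⟩
  · rw [← cancel_mono (K.iCycles n)]
    apply (hφ n).1
    simpa using congr($hfg ≫ L.iCycles n)
  · obtain ⟨g, hg⟩ := (hφ n).2 (f ≫ L.iCycles n)
    dsimp only at hg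
    refine ⟨K.liftCycles g (n + 1) (by simp) ((hφ (n + 1)).1 ?_), ?_⟩
    · dsimp only
      rw [Category.assoc, ← φ.comm, reassoc_of% hg]
      simp
    · rw [← cancel_mono (L.iCycles n)]
      simp [hg]

variable [HasExt.{w} C]

section Vanishing

variable (N : C) (hK : ∀ i p, Subsingleton (Abelian.Ext.{w} N (K.X i) (p + 1)))
include hK

/-- `Ext^{p+1}(N, Z^{n+1})` lies between the groups of `B^{n+1}` and `H^{n+1}`, and `Ext^{p+1}(N,
B^{n+1})` embeds in `Ext^{p+2}(N, Z^n)`; the total degree is preserved. -/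
lemma subsingleton_ext_cycles (n p : ℕ)
    (h : ∀ a q, a + q = p + 1 + n → q ≤ n → Subsingleton (Abelian.Ext.{w} N (K.homology q) a)) :
    Subsingleton (Abelian.Ext.{w} N (K.cycles n) (p + 1)) := by
  induction n generalizing p with
  | zero =>
    exact Abelian.Ext.subsingleton_middle (K.boundariesSequence_shortExact (m := 0) (by simp)) N
      (Abelian.Ext.subsingleton_of_isZero N (K.isZero_boundaries (by simp)) _)
      (h _ 0 rfl le_rfl)
  | succ n ih =>
    exact Abelian.Ext.subsingleton_middle (K.boundariesSequence_shortExact (m := n) (by simp)) N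
      (Abelian.Ext.subsingleton_right (K.cyclesSequence_shortExact n) N (hK _ _)
        (ih (p + 1) fun a q haq hq => h a q (by lia) (by lia)))
      (h _ (n + 1) rfl le_rfl)

lemma subsingleton_ext_boundaries {m n : ℕ} (hm : (ComplexShape.up ℕ).prev n = m) (p : ℕ)
    (h : ∀ a q, a + q = p + 1 + n → q < n → Subsingleton (Abelian.Ext.{w} N (K.homology q) a)) :
    Subsingleton (Abelian.Ext.{w} N (K.boundaries m n) (p + 1)) := by
  cases n with
  | zero =>
    exact Abelian.Ext.subsingleton_of_isZero N (K.isZero_boundaries (by simp)) _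
  | succ n =>
    obtain rfl : n = m := by simpa using hm
    exact Abelian.Ext.subsingleton_right (K.cyclesSequence_shortExact n) N (hK _ _)
      (K.subsingleton_ext_cycles N hK n (p + 1) fun a q haq hq => h a q (by lia) (by lia))

end Vanishing

variable (R : Type t) [CommRing R] [Linear R C] (N : C)

/-- The map from homomorphisms into `K.X m` to homomorphisms into the cycles of degree `n`. -/
noncomputable abbrev extZeroToCycles (m n : ℕ) :
    Abelian.Ext.{w} N (K.X m) 0 →ₗ[R] Abelian.Ext.{w} N (K.cycles n) 0 :=
  (Abelian.Ext.mk₀ (K.toCycles m n)).postcompOfLinear R N (add_zero 0)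

/-- When `m` precedes `n`, this is the cohomology in degree `n` of the complex of
homomorphisms from `N` into `K`. -/
noncomputable abbrev homCohomology (m n : ℕ) : Type w :=
  Abelian.Ext.{w} N (K.cycles n) 0 ⧸ LinearMap.range (K.extZeroToCycles R N m n)

lemma extZeroToCycles_eq_comp (m n : ℕ) :
    K.extZeroToCycles R N m n =
      (Abelian.Ext.mk₀ (image.ι (K.toCycles m n))).postcompOfLinear R N (add_zero 0) ∘ₗ
        (Abelian.Ext.mk₀ (factorThruImage (K.toCycles m n))).postcompOfLinear R N (add_zero 0) := by
  ext x
  simp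

section Main

variable {R N}

/-- `Ext^1(N, Z^n)` is the cokernel of `Hom(N, K^n) → Hom(N, B^{n+1})`, and `Hom(N, H^{n+1}) = 0`
identifies `Hom(N, B^{n+1})` with `Hom(N, Z^{n+1})`. -/
lemma nonempty_extOne_cycles_equiv (n : ℕ) (hX : Subsingleton (Abelian.Ext.{w} N (K.X n) 1))
    (h : Subsingleton (Abelian.Ext.{w} N (K.homology (n + 1)) 0)) :
    Nonempty (Abelian.Ext.{w} N (K.cycles n) 1 ≃ₗ[R] K.homCohomology R N n (n + 1)) := by
  have hB := K.boundariesSequence_shortExact (m := n) (n := n + 1) (by simp)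
  have hZ := K.cyclesSequence_shortExact n
  let ι : Abelian.Ext.{w} N (K.boundaries n (n + 1)) 0 →ₗ[R]
      Abelian.Ext.{w} N (K.cycles (n + 1)) 0 :=
    (Abelian.Ext.mk₀ (image.ι (K.toCycles n (n + 1)))).postcompOfLinear R N (add_zero 0)
  have hι : Function.Bijective ι := by
    refine ⟨Abelian.Ext.postcomp_mk₀_injective_of_mono N (image.ι (K.toCycles n (n + 1))),
      fun x => ?_⟩
    exact Abelian.Ext.covariant_sequence_exact₂ N hB x (Subsingleton.elim _ _)
  let δ : Abelian.Ext.{w} N (K.boundaries n (n + 1)) 0 →ₗ[R] Abelian.Ext.{w} N (K.cycles n) 1 :=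
    hZ.extClass.postcompOfLinear R N rfl
  have hδ : Function.Surjective δ := Abelian.Ext.postcomp_extClass_surjective hZ N hX
  refine ⟨(δ.quotKerEquivOfSurjective hδ).symm.trans
    (Submodule.Quotient.equiv _ _ (LinearEquiv.ofBijective ι hι) ?_)⟩
  rw [Abelian.Ext.ker_postcomp_extClass hZ, extZeroToCycles_eq_comp, LinearMap.range_comp]
  rfl

lemma nonempty_homCohomology_equiv_extZero {m n : ℕ} (hm : (ComplexShape.up ℕ).prev n = m)
    (hB : Subsingleton (Abelian.Ext.{w} N (K.boundaries m n) 1))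
    (h : Function.Surjective
      ((Abelian.Ext.mk₀.{w} (factorThruImage (K.toCycles m n))).postcompOfLinear R N
        (add_zero 0))) :
    Nonempty (K.homCohomology R N m n ≃ₗ[R] Abelian.Ext.{w} N (K.homology n) 0) := by
  have hS := K.boundariesSequence_shortExact hm
  refine ⟨(Submodule.quotEquivOfEq _ _ ?_).trans
    (LinearMap.quotKerEquivOfSurjective _ (Abelian.Ext.postcomp_g_surjective (R := R) hS N hB))⟩
  rw [Abelian.Ext.ker_postcomp_g hS, extZeroToCycles_eq_comp, LinearMap.range_comp,
    LinearMap.range_eq_top.2 h, Submodule.map_top]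

variable (hK : ∀ i p, Subsingleton (Abelian.Ext.{w} N (K.X i) (p + 1)))
include hK

/-- Both sides are `Ext^{p+1}(N, B^{n+1})`. -/
lemma nonempty_ext_cycles_equiv_succ (n p : ℕ)
    (h : Subsingleton (Abelian.Ext.{w} N (K.homology (n + 1)) p))
    (h' : Subsingleton (Abelian.Ext.{w} N (K.homology (n + 1)) (p + 1))) :
    Nonempty (Abelian.Ext.{w} N (K.cycles n) (p + 2) ≃ₗ[R]
      Abelian.Ext.{w} N (K.cycles (n + 1)) (p + 1)) := by
  obtain ⟨e⟩ := Abelian.Ext.nonempty_equiv_extClass (R := R) (K.cyclesSequence_shortExact n) N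
    (hK n p) (hK n (p + 1))
  obtain ⟨e'⟩ := Abelian.Ext.nonempty_equiv_f (R := R)
    (K.boundariesSequence_shortExact (m := n) (n := n + 1) (by simp)) N h h'
  exact ⟨e.symm.trans e'⟩

lemma nonempty_ext_cycles_equiv_homCohomology (n p : ℕ)
    (h : ∀ a q, a + q = p + n → n < q → Subsingleton (Abelian.Ext.{w} N (K.homology q) a))
    (h' : ∀ a q, a + q = p + 1 + n → n < q → Subsingleton (Abelian.Ext.{w} N (K.homology q) a))
    {k : ℕ} (hk : k = n + p) :
    Nonempty (Abelian.Ext.{w} N (K.cycles n) (p + 1) ≃ₗ[R] K.homCohomology R N k (k + 1)) := by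
  induction p generalizing n with
  | zero =>
    subst hk
    exact K.nonempty_extOne_cycles_equiv _ (hK _ 0) (h' 0 _ (by lia) (by lia))
  | succ p ih =>
    obtain ⟨e⟩ := K.nonempty_ext_cycles_equiv_succ (R := R) hK n p
      (h p (n + 1) (by lia) (by lia)) (h' (p + 1) (n + 1) (by lia) (by lia))
    obtain ⟨e'⟩ := ih (n + 1) (fun a q ha hq => h a q (by lia) (by lia))
      (fun a q ha hq => h' a q (by lia) (by lia)) (by lia)
    exact ⟨e.trans e'⟩

/-- If the terms `Ext^a (N, H^q K)` of total degree `s + t` vanish except for `q = t`, and those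
of the two adjacent total degrees vanish wherever a differential could relate them to
`Ext^s (N, H^t K)`, then the latter is the cohomology of `Hom (N, K)` in degree `s + t`. -/
theorem nonempty_homCohomology_equiv (s t : ℕ)
    (h₁ : ∀ a q, a + q = s + t → q ≠ t → Subsingleton (Abelian.Ext.{w} N (K.homology q) a))
    (h₂ : ∀ a q, a + q = s + t + 1 → q < t → Subsingleton (Abelian.Ext.{w} N (K.homology q) a))
    (h₃ : ∀ a q, a + q + 1 = s + t → t < q → Subsingleton (Abelian.Ext.{w} N (K.homology q) a))
    {m n : ℕ} (hm : (ComplexShape.up ℕ).prev n = m) (hn : n = s + t) :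
    Nonempty (K.homCohomology R N m n ≃ₗ[R] Abelian.Ext.{w} N (K.homology t) s) := by
  cases s with
  | zero =>
    -- For `s = 0`, total degree `t + 1` kills `Ext^1(N, B^t)`, and total degree `t` lets maps `N →
    -- B^t` lift to `K^{t-1}`.
    obtain rfl : n = t := by lia
    refine K.nonempty_homCohomology_equiv_extZero hm
      (K.subsingleton_ext_boundaries N hK hm 0 fun a q ha hq => h₂ a q (by lia) hq) ?_
    cases n with
    | zero =>
      have := Abelian.Ext.subsingleton_of_isZero.{w} N
        (K.isZero_boundaries (m := m) (n := 0) (by simp)) 0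
      exact fun x => ⟨0, Subsingleton.elim _ _⟩
    | succ n =>
      obtain rfl : n = m := by simpa using hm
      exact Abelian.Ext.postcomp_g_surjective (K.cyclesSequence_shortExact n) N
        (K.subsingleton_ext_cycles N hK n 0 fun a q ha hq => h₁ a q (by lia) (by lia))
  | succ s =>
    obtain ⟨e⟩ := Abelian.Ext.nonempty_equiv_g (R := R) (n := s + 1)
      (K.boundariesSequence_shortExact (n := t) rfl) N
      (K.subsingleton_ext_boundaries N hK rfl s fun a q ha hq => h₁ a q (by lia) (by lia))
      (K.subsingleton_ext_boundaries N hK rfl (s + 1) fun a q ha hq => h₂ a q (by lia) hq)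
    obtain rfl : n = t + s + 1 := by lia
    obtain rfl : t + s = m := by simpa using hm
    obtain ⟨e'⟩ := K.nonempty_ext_cycles_equiv_homCohomology (R := R) hK t s
      (fun a q ha hq => h₃ a q (by lia) hq) (fun a q ha hq => h₁ a q (by lia) (by lia)) rfl
    exact ⟨e'.symm.trans e⟩

end Main

variable {K N} in
theorem nonempty_homCohomology_equiv_of_bijective {L : CochainComplex C ℕ} (φ : K ⟶ L)
    (hφ : ∀ i, Function.Bijective fun f : N ⟶ K.X i => f ≫ φ.f i) (m n : ℕ) :
    Nonempty (K.homCohomology R N m n ≃ₗ[R] L.homCohomology R N m n) := by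
  have h₁ := Abelian.Ext.bijective_extZero_postcomp.{w} R _ (hφ m)
  have h₂ := Abelian.Ext.bijective_extZero_postcomp.{w} R _ (K.bijective_comp_cyclesMap φ hφ n)
  refine ⟨Submodule.Quotient.equiv _ _ (LinearEquiv.ofBijective _ h₂) ?_⟩
  have h : (Abelian.Ext.mk₀.{w} (HomologicalComplex.cyclesMap φ n)).postcompOfLinear R N
        (add_zero 0) ∘ₗ
      K.extZeroToCycles R N m n =
      L.extZeroToCycles R N m n ∘ₗ
        (Abelian.Ext.mk₀.{w} (φ.f m)).postcompOfLinear R N (add_zero 0) := by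
    ext x
    have hc : K.toCycles m n ≫ HomologicalComplex.cyclesMap φ n = φ.f m ≫ L.toCycles m n := by
      rw [← cancel_mono (L.iCycles n)]
      simp
    simp [hc]
  have h' := congr(LinearMap.range $h)
  rw [LinearMap.range_comp, LinearMap.range_comp_of_range_eq_top _
    (LinearMap.range_eq_top.2 h₁.2)] at h'
  exact h'

end CochainComplex

/-! ### Torsion, Artin-Rees and injectives -/

namespace SystemOfIdeals

variable {R : Type u} [CommRing R] (Φ : SystemOfIdeals R)

lemma exists_le_pow {a : Ideal R} (ha : a ∈ Φ.ideals) (k : ℕ) : ∃ b ∈ Φ.ideals, b ≤ a ^ k := by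
  induction k with
  | zero => exact ⟨a, ha, by simp⟩
  | succ k ih =>
    obtain ⟨b, hb, hbk⟩ := ih
    obtain ⟨c, hc, hcb⟩ := Φ.exists_le_mul b hb a ha
    exact ⟨c, hc, hcb.trans (by rw [pow_succ]; exact Ideal.mul_mono_left hbk)⟩

lemma exists_le_annihilator {N : Type v} [AddCommGroup N] [Module R N] [Module.Finite R N]
    (hN : Φ.IsTorsion N) : ∃ a ∈ Φ.ideals, ∀ r ∈ a, ∀ x : N, r • x = 0 := by
  suffices h : ∀ P : Submodule R N, P.FG → ∃ a ∈ Φ.ideals, ∀ r ∈ a, ∀ x ∈ P, r • x = 0 by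
    obtain ⟨a, ha, h⟩ := h ⊤ Module.Finite.fg_top
    exact ⟨a, ha, fun r hr x => h r hr x trivial⟩
  intro P hP
  induction P, hP using Submodule.fg_induction with
  | singleton x =>
    have hx : x ∈ Φ.torsionSubmodule N := hN ▸ Submodule.mem_top
    obtain ⟨a, ha, h⟩ := hx
    refine ⟨a, ha, fun r hr y hy => ?_⟩
    obtain ⟨c, rfl⟩ := Submodule.mem_span_singleton.1 hy
    rw [smul_comm, h r hr, smul_zero]
  | sup P Q _ _ hP hQ =>
    obtain ⟨a, ha, hP⟩ := hP
    obtain ⟨b, hb, hQ⟩ := hQ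
    obtain ⟨c, hc, hcab⟩ := Φ.exists_le_mul a ha b hb
    refine ⟨c, hc, fun r hr x hx => ?_⟩
    obtain ⟨y, hy, z, hz, rfl⟩ := Submodule.mem_sup.1 hx
    have hr' := Ideal.mul_le_inf (hcab hr)
    rw [smul_add, hP r hr'.1 y hy, hQ r hr'.2 z hz, add_zero]

/-- `Γ_Φ` preserves injectivity over a Noetherian ring, by the Artin-Rees lemma. -/
lemma baer_torsionSubmodule [IsNoetherianRing R] {M : Type v} [AddCommGroup M] [Module R M]
    (hM : Module.Baer R M) : Module.Baer R (Φ.torsionSubmodule M) := by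
  intro I f
  have hf : Φ.IsTorsion (LinearMap.range f) := by
    refine eq_top_iff.2 fun x _ => ?_
    obtain ⟨a, ha, h⟩ := x.1.2
    exact ⟨a, ha, fun r hr => Subtype.ext (Subtype.ext (h r hr))⟩
  -- The image of `f` is finitely generated since `R` is Noetherian, so one ideal `a` of `Φ` kills
  -- it.
  obtain ⟨a, ha, haf⟩ := Φ.exists_le_annihilator hf
  obtain ⟨k, hk⟩ := Ideal.exists_pow_inf_eq_pow_smul a (I : Submodule R R)
  have hker : a ^ (k + 1) ⊓ I ≤ a • I := by
    -- The exponent `k + 1` leaves exactly one factor `a` outside the intersection.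
    have := hk (k + 1) (by lia)
    rw [Ideal.smul_eq_mul, Ideal.mul_top, Nat.add_sub_cancel_left, pow_one] at this
    rw [this]
    exact Submodule.smul_mono le_rfl inf_le_right
  have haI : ∀ x (hx : x ∈ I), x ∈ a • I → f ⟨x, hx⟩ = 0 := by
    intro x hx hxa
    have key : a • I ≤ (LinearMap.ker f).map (Submodule.subtype I) := by
      refine Submodule.smul_le.2 fun r hr y hy => ⟨r • ⟨y, hy⟩, ?_, rfl⟩
      have := haf r hr ⟨f ⟨y, hy⟩, ⟨_, rfl⟩⟩
      exact (map_smul f r _).trans (congr_arg Subtype.val this)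
    obtain ⟨y, hy, rfl⟩ := key hxa
    exact hy
  let π := (a ^ (k + 1)).mkQ
  let i : I →ₗ[R] R ⧸ a ^ (k + 1) := π ∘ₗ Submodule.subtype I
  have hi : LinearMap.ker i ≤ LinearMap.ker f := by
    intro x hx
    have hx' : (x : R) ∈ a ^ (k + 1) := (Submodule.Quotient.mk_eq_zero _).1 hx
    exact haI x x.2 (hker ⟨hx', x.2⟩)
  let e : (I ⧸ LinearMap.ker i) →ₗ[R] R ⧸ a ^ (k + 1) := (LinearMap.ker i).liftQ i le_rfl
  have he : Function.Injective e := by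
    rw [← LinearMap.ker_eq_bot]
    exact Submodule.ker_liftQ_eq_bot _ _ _ le_rfl
  -- Extending from `R ⧸ a ^ (k + 1)` rather than `R` forces the values to be killed by `a ^ (k +
  -- 1)`, hence to be torsion.
  obtain ⟨g, hg⟩ := hM.extension_property e he
    ((LinearMap.ker i).liftQ ((Φ.torsionSubmodule M).subtype ∘ₗ f)
      (by rw [LinearMap.ker_comp_of_ker_eq_bot _ (Submodule.ker_subtype _)]; exact hi))
  obtain ⟨b, hb, hbk⟩ := Φ.exists_le_pow ha (k + 1)
  refine ⟨(g ∘ₗ π).codRestrict _ fun x => ⟨b, hb, fun r hr => ?_⟩, fun x hx => ?_⟩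
  · rw [← map_smul, LinearMap.comp_apply,
      show π (r • x) = 0 from (Submodule.Quotient.mk_eq_zero _).2
        (Ideal.mul_mem_right x _ (hbk hr)), map_zero]
  · exact Subtype.ext congr($hg (Submodule.Quotient.mk ⟨x, hx⟩))

instance injective_torsionFunctor_obj [IsNoetherianRing R] [Small.{v} R] (M : ModuleCat.{v} R)
    [Injective M] : Injective (Φ.torsionFunctor.obj M) := by
  have : Module.Injective R M := Module.injective_module_of_injective_object R M
  have : Module.Injective R (Φ.torsionSubmodule M) :=
    (Φ.baer_torsionSubmodule (Module.Baer.of_injective this)).injective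
  exact Module.injective_object_of_injective_module R _

/-- The inclusion of `Γ_Φ` in the identity functor. -/
def torsionInclusion : torsionFunctor.{u, v} Φ ⟶ 𝟭 _ where
  app M := ModuleCat.ofHom (Φ.torsionSubmodule M).subtype

lemma bijective_comp_torsionInclusion {N : ModuleCat.{v} R} (hN : Φ.IsTorsion N)
    (M : ModuleCat.{v} R) :
    Function.Bijective fun f : N ⟶ Φ.torsionFunctor.obj M => f ≫ Φ.torsionInclusion.app M := by
  refine ⟨fun f g hfg => ?_, fun f => ?_⟩
  · ext x
    exact Subtype.ext congr($(hfg).hom x)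
  · refine ⟨ModuleCat.ofHom (f.hom.codRestrict _ fun x =>
      Φ.map_mem_torsionSubmodule f.hom (hN ▸ Submodule.mem_top)), ?_⟩
    rfl

end SystemOfIdeals

/-! ### `Ext` from an injective resolution -/

namespace CategoryTheory.InjectiveResolution

universe w t v' u'

variable {C : Type u'} [Category.{v'} C] [Abelian C] [HasExt.{w} C]
  {M : C} (I : InjectiveResolution M)

/-- The homology in degree zero of an injective resolution. -/
noncomputable def homologyZeroIso : I.cocomplex.homology 0 ≅ M :=
  ((HomologicalComplex.singleObjHomologySelfIso _ _ _).symm ≪≫ isoOfQuasiIsoAt I.ι 0).symm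

lemma nonempty_homCohomology_equiv (R : Type t) [CommRing R] [Linear R C] (N : C) {m n : ℕ}
    (hm : (ComplexShape.up ℕ).prev n = m) :
    Nonempty (I.cocomplex.homCohomology R N m n ≃ₗ[R] Abelian.Ext.{w} N M n) := by
  have h : ∀ a q, 0 < q → Subsingleton (Abelian.Ext.{w} N (I.cocomplex.homology q) a) := by
    rintro a (_ | q) hq
    · lia
    · exact Abelian.Ext.subsingleton_of_isZero N (I.cocomplex_exactAt_succ q).isZero_homology a
  -- The shifting theorem with `t = 0`: all cohomology sits in degree `0`, where it is `M`.
  obtain ⟨e⟩ := I.cocomplex.nonempty_homCohomology_equiv (R := R) (N := N)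
    (fun i p => Abelian.Ext.subsingleton_of_injective N (I.cocomplex.X i) p) n 0
    (fun a q _ hq => h a q (by lia)) (fun a q _ hq => by lia) (fun a q _ hq => h a q hq) hm rfl
  exact ⟨e.trans (Abelian.Ext.postcompIso R N I.homologyZeroIso n)⟩

end CategoryTheory.InjectiveResolution

/-! ### Comparison of `Hom(N, Γ_Φ(I))` with `Hom(N, I)` -/

theorem theorem4p4 {R : Type u} [CommRing R] [IsNoetherianRing R] [Small.{v} R]
    (Φ : SystemOfIdeals R) (N M : ModuleCat.{v} R) [Module.Finite R N] (hN : Φ.IsTorsion N)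
    (s t : ℕ)
    (h₁ : ∀ i : ℕ, (i < t ∨ (t + 1 ≤ i ∧ i ≤ s + t)) →
      Subsingleton (Abelian.Ext.{v} N ((Φ.localCohomology i).obj M) (s + t - i)))
    (h₂ : ∀ i : ℕ, i ≤ t →
      Subsingleton (Abelian.Ext.{v} N ((Φ.localCohomology (t - i)).obj M) (s + 1 + i)))
    (h₃ : ∀ i : ℕ, i < s →
      Subsingleton (Abelian.Ext.{v} N ((Φ.localCohomology (t + i)).obj M) (s - 1 - i))) :
    Nonempty (Abelian.Ext.{v} N M (s + t) ≃ₗ[R]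
      Abelian.Ext.{v} N ((Φ.localCohomology t).obj M) s) := by
  let I := injectiveResolution M
  let J : CochainComplex (ModuleCat.{v} R) ℕ :=
    (Φ.torsionFunctor.mapHomologicalComplex (ComplexShape.up ℕ)).obj I.cocomplex
  let φ : J ⟶ I.cocomplex :=
    (NatTrans.mapHomologicalComplex Φ.torsionInclusion (ComplexShape.up ℕ)).app I.cocomplex ≫
      (Functor.mapHomologicalComplexIdIso _ _).hom.app I.cocomplex
  have hφ : ∀ i, Function.Bijective fun f : N ⟶ J.X i => f ≫ φ.f i := fun i => by
    have h : φ.f i = Φ.torsionInclusion.app (I.cocomplex.X i) := Category.comp_id _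
    rw [h]
    exact Φ.bijective_comp_torsionInclusion hN (I.cocomplex.X i)
  have e (q a : ℕ) : Abelian.Ext.{v} N (J.homology q) a ≃ₗ[R]
      Abelian.Ext.{v} N ((Φ.localCohomology q).obj M) a :=
    Abelian.Ext.postcompIso R N (I.isoRightDerivedObj Φ.torsionFunctor q).symm a
  have hJ : ∀ i, Injective (J.X i) := fun i =>
    Φ.injective_torsionFunctor_obj (I.cocomplex.X i)
  obtain ⟨e₁⟩ := J.nonempty_homCohomology_equiv (R := R) (N := N)
    (fun i p => Abelian.Ext.subsingleton_of_injective N (J.X i) p) s t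
    (fun a q ha hq => by
      have := h₁ q (by lia)
      rw [show s + t - q = a by lia] at this
      exact (e q a).subsingleton)
    (fun a q ha hq => by
      have := h₂ (t - q) (by lia)
      rw [show s + 1 + (t - q) = a by lia, show t - (t - q) = q by lia] at this
      exact (e q a).subsingleton)
    (fun a q ha hq => by
      have := h₃ (q - t) (by lia)
      rw [show s - 1 - (q - t) = a by lia, show t + (q - t) = q by lia] at this
      exact (e q a).subsingleton) rfl rfl
  obtain ⟨e₂⟩ := CochainComplex.nonempty_homCohomology_equiv_of_bijective R φ hφ
    ((ComplexShape.up ℕ).prev (s + t)) (s + t)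
  obtain ⟨e₃⟩ := I.nonempty_homCohomology_equiv R N (n := s + t) rfl
  exact ⟨e₃.symm.trans (e₂.symm.trans (e₁.trans (e t s)))⟩
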